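/- Let $G=(V,E)$ be a finite simple graph of order $n=|V|$ that is not complete. For a finite simple graph $H$, let $P(H,x)$ denote its chromatic polynomial, i.e. the unique real polynomial in $x$ such that, for every positive integer $k$, $P(H,k)$ is the number of proper colorings $V(H)\to\{1,\dots,k\}$. For $u\in V$ let $G-u$ denote the subgraph of $G$ induced by $V\setminus\{u\}$. Then for every real number $x<0$, $$(-1)^{n}(x-n+1)\sum_{u\in V}P(G-u,x)+(-1)^{n+1}\,n\,P(G,x)>0.$$ -/

import Mathlib

namespace SimpleGraph

/-- There is exactly one real polynomial whose value at each positive integer `k` is the number of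
proper `k`-colorings of the finite graph `G`. -/
theorem existsUnique_chromaticPolynomial {V : Type*} [Finite V] (G : SimpleGraph V) :
    ∃! p : Polynomial ℝ, ∀ k : ℕ, 0 < k →
      p.eval (k : ℝ) = (Nat.card (G.Coloring (Fin k)) : ℝ) := by
  classical
  -- Existence: sort the colorings by their kernels, the partitions of `V` into independent sets.
  have hex : ∃ p : Polynomial ℝ, ∀ k : ℕ, 0 < k →
      p.eval (k : ℝ) = (Nat.card (G.Coloring (Fin k)) : ℝ) := by
    have : Finite (Setoid V) :=
      Finite.of_injective (fun r : Setoid V => fun a b => r a b)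
        (fun r s h => Setoid.ext fun a b => by
          have := congrFun (congrFun h a) b
          exact Iff.of_eq this)
    let R := {r : Setoid V // ∀ a b, G.Adj a b → ¬ r a b}
    have : Fintype R := Fintype.ofFinite R
    refine ⟨∑ r : R, descPochhammer ℝ (Nat.card (Quotient r.1)), fun k _ => ?_⟩
    let e : G.Coloring (Fin k) ≃ Σ r : R, (Quotient r.1 ↪ Fin k) :=
      Equiv.ofBijective
        (fun C => ⟨⟨Setoid.ker C, fun a b hab h => C.valid hab h⟩,
          ⟨Quotient.lift C fun _ _ h => h, by
            rintro ⟨a⟩ ⟨b⟩ h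
            exact Quotient.sound h⟩⟩)
        (by
          constructor
          · intro C D h
            have key : ∀ s t : (Σ r : R, (Quotient r.1 ↪ Fin k)), s = t →
                ∀ v, s.2 (Quotient.mk _ v) = t.2 (Quotient.mk _ v) := by
              rintro s t rfl v
              rfl
            exact RelHom.ext fun v => key _ _ h v
          · rintro ⟨⟨r, hr⟩, f⟩
            have hker : Setoid.ker (fun v => f (Quotient.mk r v)) = r := by
              ext a b
              exact ⟨fun h => Quotient.exact (f.injective h), fun h => congrArg f (Quotient.sound h)⟩
            refine ⟨Coloring.mk (fun v => f (Quotient.mk r v)) (fun {a b} hab h =>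
              hr a b hab (Quotient.exact (f.injective h))), ?_⟩
            have key : ∀ (s : Setoid V) (hs : ∀ a b, G.Adj a b → ¬ s a b)
                (g : Quotient s ↪ Fin k), s = r →
                (∀ v, g (Quotient.mk s v) = f (Quotient.mk r v)) →
                (⟨⟨s, hs⟩, g⟩ : Σ r : R, (Quotient r.1 ↪ Fin k)) = ⟨⟨r, hr⟩, f⟩ := by
              rintro s hs g rfl hg
              have : g = f := by
                ext ⟨v⟩
                exact congrArg Fin.val (hg v)
              rw [this]
            exact key _ _ _ hker fun v => rfl)
    rw [Nat.card_congr e, Nat.card_sigma, Polynomial.eval_finsetSum, Nat.cast_sum]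
    refine Finset.sum_congr rfl fun r _ => ?_
    haveI : Fintype (Quotient r.1) := Fintype.ofFinite _
    rw [descPochhammer_eval_eq_descFactorial, Nat.card_eq_fintype_card, Nat.card_eq_fintype_card,
      Fintype.card_embedding_eq, Fintype.card_fin]
  obtain ⟨p, hp⟩ := hex
  refine ⟨p, hp, fun q hq => ?_⟩
  refine Polynomial.eq_of_infinite_eval_eq q p ?_
  refine Set.Infinite.mono (s := Set.range fun k : ℕ => ((k + 1 : ℕ) : ℝ)) ?_
    (Set.infinite_range_of_injective fun a b h => ?_)
  · rintro _ ⟨k, rfl⟩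
    exact (hq _ k.succ_pos).trans (hp _ k.succ_pos).symm
  · have : a + 1 = b + 1 := Nat.cast_injective h
    omega

/-- The chromatic polynomial of a finite graph `G`: the polynomial whose value at each positive
integer `k` is the number of proper `k`-colorings of `G`. -/
noncomputable def chromaticPolynomial {V : Type*} [Finite V] (G : SimpleGraph V) :
    Polynomial ℝ :=
  Classical.choose (existsUnique_chromaticPolynomial G).exists

/-- The defining property of the chromatic polynomial. -/
theorem chromaticPolynomial_eval_natCast {V : Type*} [Finite V] (G : SimpleGraph V)
    (k : ℕ) (hk : 0 < k) :
    G.chromaticPolynomial.eval (k : ℝ) = (Nat.card (G.Coloring (Fin k)) : ℝ) :=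
  Classical.choose_spec (existsUnique_chromaticPolynomial G).exists k hk

end SimpleGraph

namespace SimpleGraph

open Polynomial Finset

/-! Put `y = -x`, `q_T(y) = (-1)^|T| P(G[T], -y)`, and let `b(T)` be the linear coefficient of
`P(G[T])` up to sign. Splitting a palette in two gives `P(G[T], x + l) = ∑ P(G[S], x) P(G[T \ S],
l)` over `S ⊆ T`; the derivative at `x = 0` yields `q_T' = ∑ b(S) q_{T \ S}`.

The claim is `F_V(y) > 0` for `F_T(y) = (y + |T| - 1) ∑ q_{T-u}(y) - |T| q_T(y)`. Here `F_T(0) = 0`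
and `F_T' = ∑ (b(S) F_{T \ S} + e(S) q_{T \ S})`, where `e(S) = (|S| - 1) ∑ b(S - u) - |S| b(S)`,
plus one when `|S| = 1`. Since `b ≥ 0`, `q > 0` and `b(∅) = 0`, induction on `T` reduces `F ≥ 0` to
`e ≥ 0`. This follows by summing `b(T) ≤ ∑_{u ≠ s} b(T - u)` (`linearCoeffOn_le_sum`, by
deletion–contraction at `s`) over `s`. A non-adjacent pair has `e > 0`, which makes the inequality
strict. -/

theorem polynomial_eq_of_eval_pos_nat {p q : ℝ[X]}
    (h : ∀ k : ℕ, 0 < k → p.eval (k : ℝ) = q.eval (k : ℝ)) : p = q := by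
  refine Polynomial.eq_of_infinite_eval_eq p q ?_
  refine Set.Infinite.mono (s := Set.range fun k : ℕ => ((k + 1 : ℕ) : ℝ)) ?_
    (Set.infinite_range_of_injective fun a b h => ?_)
  · rintro _ ⟨k, rfl⟩
    exact h _ k.succ_pos
  · have : a + 1 = b + 1 := Nat.cast_injective h
    omega

/-! ### Chromatic polynomials of induced subgraphs. -/

variable {V : Type*}

/-- The chromatic polynomial of the subgraph of `G` induced by the finite set `T`. -/
noncomputable def chromaticPolynomialOn (G : SimpleGraph V) (T : Finset V) : ℝ[X] :=
  (G.induce (T : Set V)).chromaticPolynomial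

/-- Proper colorings by `α` of the subgraph of `G` induced by `T`. -/
abbrev ColoringOn (G : SimpleGraph V) (T : Finset V) (α : Type*) : Type _ :=
  {c : T → α // ∀ a b : T, G.Adj a b → c a ≠ c b}

theorem eval_chromaticPolynomialOn (G : SimpleGraph V) (T : Finset V) {k : ℕ} (hk : 0 < k) :
    (G.chromaticPolynomialOn T).eval (k : ℝ) = (Nat.card (G.ColoringOn T (Fin k)) : ℝ) := by
  rw [chromaticPolynomialOn, chromaticPolynomial_eval_natCast _ k hk]
  congr 1
  exact Nat.card_congr
    { toFun := fun c => ⟨fun v => c ⟨v.1, v.2⟩, fun a b h => c.valid (v := ⟨a.1, a.2⟩)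
        (w := ⟨b.1, b.2⟩) h⟩
      invFun := fun c => Coloring.mk (fun v => c.1 ⟨v.1, v.2⟩) fun {a b} h =>
        c.2 ⟨a.1, a.2⟩ ⟨b.1, b.2⟩ h
      left_inv := fun c => RelHom.ext fun v => rfl
      right_inv := fun c => rfl }

theorem chromaticPolynomialOn_congr {G H : SimpleGraph V} {T : Finset V}
    (h : ∀ a ∈ T, ∀ b ∈ T, G.Adj a b ↔ H.Adj a b) :
    G.chromaticPolynomialOn T = H.chromaticPolynomialOn T := by
  have : G.induce (T : Set V) = H.induce (T : Set V) := by
    ext a b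
    exact h a a.2 b b.2
  rw [chromaticPolynomialOn, this, chromaticPolynomialOn]

theorem chromaticPolynomialOn_univ [Fintype V] (G : SimpleGraph V) :
    G.chromaticPolynomialOn univ = G.chromaticPolynomial := by
  refine polynomial_eq_of_eval_pos_nat fun k hk => ?_
  rw [eval_chromaticPolynomialOn _ _ hk, chromaticPolynomial_eval_natCast _ k hk]
  congr 1
  exact Nat.card_congr
    { toFun := fun c => Coloring.mk (fun v => c.1 ⟨v, mem_univ v⟩) fun {a b} h => c.2 _ _ h
      invFun := fun c => ⟨fun v => c v.1, fun a b h => c.valid h⟩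
      left_inv := fun c => rfl
      right_inv := fun c => RelHom.ext fun v => rfl }

theorem chromaticPolynomialOn_empty (G : SimpleGraph V) : G.chromaticPolynomialOn ∅ = 1 := by
  refine polynomial_eq_of_eval_pos_nat fun k hk => ?_
  rw [eval_chromaticPolynomialOn _ _ hk, eval_one, ← Nat.cast_one, Nat.cast_inj,
    Nat.card_eq_one_iff_unique]
  exact ⟨⟨fun a b => Subtype.ext (funext fun v => (notMem_empty _ v.2).elim)⟩,
    ⟨⟨fun v => (notMem_empty _ v.2).elim, fun v => (notMem_empty _ v.2).elim⟩⟩⟩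

variable [DecidableEq V]

theorem chromaticPolynomialOn_of_isolated (G : SimpleGraph V) {T : Finset V} {s : V}
    (hs : s ∈ T) (h : ∀ a ∈ T, ¬ G.Adj s a) :
    G.chromaticPolynomialOn T = X * G.chromaticPolynomialOn (T.erase s) := by
  refine polynomial_eq_of_eval_pos_nat fun k hk => ?_
  rw [eval_mul, eval_X, eval_chromaticPolynomialOn _ _ hk, eval_chromaticPolynomialOn _ _ hk,
    ← Nat.cast_mul, Nat.cast_inj]
  conv_rhs => rw [← Nat.card_fin k, ← Nat.card_prod, Nat.card_fin k]
  refine Nat.card_congr (Equiv.ofBijective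
    (fun c => (c.1 ⟨s, hs⟩, ⟨fun v => c.1 ⟨v.1, mem_of_mem_erase v.2⟩, fun a b hab => c.2 _ _ hab⟩))
    ⟨fun c d hcd => ?_, fun ⟨i, c⟩ => ?_⟩)
  · have hcd := Prod.mk.inj hcd
    refine Subtype.ext (funext fun v => ?_)
    by_cases hv : v.1 = s
    · obtain ⟨v, hv'⟩ := v
      subst hv
      exact hcd.1
    · exact congrFun (congrArg Subtype.val hcd.2) ⟨v.1, mem_erase.2 ⟨hv, v.2⟩⟩
  · refine ⟨⟨fun v => if hv : v.1 = s then i else c.1 ⟨v.1, mem_erase.2 ⟨hv, v.2⟩⟩, ?_⟩, ?_⟩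
    · intro a b hab
      have ha : a.1 ≠ s := fun e => h b b.2 (e ▸ hab)
      have hb : b.1 ≠ s := fun e => h a a.2 (e ▸ hab.symm)
      simp only [ha, hb, dite_false]
      exact c.2 _ _ hab
    · refine Prod.ext (by simp) (Subtype.ext (funext fun v => ?_))
      simp [ne_of_mem_erase v.2]

/-! ### Deletion and contraction of an edge. -/

/-- The graph obtained from `G` by joining `s` to all the neighbours of `w` other than `s`;
restricted to sets avoiding `w`, it is the contraction of `w` into `s`. -/
def mergeInto (G : SimpleGraph V) (s w : V) : SimpleGraph V :=
  G ⊔ fromRel fun a b => a = s ∧ G.Adj w b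

/-- Deletion–contraction. -/
theorem chromaticPolynomialOn_deleteEdges (G : SimpleGraph V) {T : Finset V} {s w : V}
    (hs : s ∈ T) (hw : w ∈ T) (h : G.Adj s w) :
    (G.deleteEdges {s(s, w)}).chromaticPolynomialOn T =
      G.chromaticPolynomialOn T + (G.mergeInto s w).chromaticPolynomialOn (T.erase w) := by
  have hsw : s ≠ w := h.ne
  refine polynomial_eq_of_eval_pos_nat fun k hk => ?_
  rw [eval_add, eval_chromaticPolynomialOn _ _ hk, eval_chromaticPolynomialOn _ _ hk,
    eval_chromaticPolynomialOn _ _ hk, ← Nat.cast_add, Nat.cast_inj, ← Nat.card_sum]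
  symm
  have hs' : s ∈ T.erase w := mem_erase.2 ⟨hsw, hs⟩
  -- Colorings of the edge-deleted graph either separate `s` from `w` (left summand) or give them
  -- the same color (right summand).
  let Φ : G.ColoringOn T (Fin k) ⊕ (G.mergeInto s w).ColoringOn (T.erase w) (Fin k) →
      (G.deleteEdges {s(s, w)}).ColoringOn T (Fin k) := Sum.elim
    (fun c => ⟨c.1, fun a b hab => c.2 a b (deleteEdges_le _ hab)⟩)
    (fun c => ⟨fun v => if hv : v.1 = w then c.1 ⟨s, hs'⟩ else c.1 ⟨v.1, mem_erase.2 ⟨hv, v.2⟩⟩, by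
      intro a b hab
      rw [deleteEdges_adj] at hab
      obtain ⟨hab, he⟩ := hab
      by_cases ha : a.1 = w <;> by_cases hb : b.1 = w
      · exact absurd (ha.trans hb.symm) hab.ne
      · have hbs : b.1 ≠ s := fun e => he (by simp [ha, e, Sym2.eq_swap])
        simp only [ha, hb, dite_true, dite_false]
        refine c.2 _ _ (Or.inr ?_)
        rw [fromRel_adj]
        exact ⟨fun e => hbs e.symm, Or.inl ⟨rfl, ha ▸ hab⟩⟩
      · have has : a.1 ≠ s := fun e => he (by simp [hb, e])
        simp only [ha, hb, dite_true, dite_false]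
        refine c.2 _ _ (Or.inr ?_)
        rw [fromRel_adj]
        exact ⟨has, Or.inr ⟨rfl, hb ▸ hab.symm⟩⟩
      · simp only [ha, hb, dite_false]
        exact c.2 _ _ (Or.inl hab)⟩)
  have Φr (c : (G.mergeInto s w).ColoringOn (T.erase w) (Fin k)) (v : T) : (Φ (Sum.inr c)).1 v =
    if hv : v.1 = w then c.1 ⟨s, hs'⟩ else c.1 ⟨v.1, mem_erase.2 ⟨hv, v.2⟩⟩ := rfl
  have Φl (c : G.ColoringOn T (Fin k)) (v : T) : (Φ (Sum.inl c)).1 v = c.1 v := rfl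
  have hr (c : (G.mergeInto s w).ColoringOn (T.erase w) (Fin k)) :
      (Φ (Sum.inr c)).1 ⟨s, hs⟩ = (Φ (Sum.inr c)).1 ⟨w, hw⟩ := by
    rw [Φr, Φr]
    simp [hsw]
  have hl (c : G.ColoringOn T (Fin k)) :
      (Φ (Sum.inl c)).1 ⟨s, hs⟩ ≠ (Φ (Sum.inl c)).1 ⟨w, hw⟩ := c.2 ⟨s, hs⟩ ⟨w, hw⟩ h
  refine Nat.card_congr (Equiv.ofBijective Φ ⟨?_, fun c => ?_⟩)
  · rintro (c | c) (d | d) hcd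
    · exact congrArg Sum.inl (Subtype.ext (funext fun v => by rw [← Φl c, ← Φl d, hcd]))
    · exact (hl c (hcd ▸ hr d)).elim
    · exact (hl d (hcd ▸ hr c)).elim
    · refine congrArg Sum.inr (Subtype.ext (funext fun v => ?_))
      have e : (Φ (Sum.inr c)).1 ⟨v, mem_of_mem_erase v.2⟩ =
        (Φ (Sum.inr d)).1 ⟨v, mem_of_mem_erase v.2⟩ := by rw [hcd]
      rw [Φr, Φr] at e
      simpa [ne_of_mem_erase v.2] using e
  · by_cases hc : c.1 ⟨s, hs⟩ = c.1 ⟨w, hw⟩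
    · refine ⟨Sum.inr ⟨fun v => c.1 ⟨v.1, mem_of_mem_erase v.2⟩, ?_⟩, ?_⟩
      · have key (b : V) (hb : b ∈ T) (hbs : b ≠ s) (hwb : G.Adj w b) :
            c.1 ⟨s, hs⟩ ≠ c.1 ⟨b, hb⟩ := by
          rw [hc]
          refine c.2 _ _ ?_
          rw [deleteEdges_adj]
          refine ⟨hwb, fun e => hbs ?_⟩
          rw [Set.mem_singleton_iff, Sym2.eq_iff] at e
          rcases e with e | e
          · exact (hsw e.1.symm).elim
          · exact e.2
        rintro ⟨a, ha⟩ ⟨b, hb⟩ hab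
        have haw := ne_of_mem_erase ha
        have hbw := ne_of_mem_erase hb
        rcases hab with hab | hab
        · refine c.2 _ _ ?_
          rw [deleteEdges_adj]
          refine ⟨hab, fun e => ?_⟩
          rw [Set.mem_singleton_iff, Sym2.eq_iff] at e
          rcases e with e | e
          · exact hbw e.2
          · exact haw e.1
        · rw [fromRel_adj] at hab
          obtain ⟨hne, ⟨rfl, hab⟩ | ⟨rfl, hab⟩⟩ := hab
          · exact key b _ hne.symm hab
          · exact (key a _ hne hab).symm
      · refine Subtype.ext (funext fun v => ?_)
        rw [Φr]
        by_cases hv : v.1 = w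
        · obtain ⟨v, hv'⟩ := v
          subst hv
          simpa using hc
        · simp [hv]
    · refine ⟨Sum.inl ⟨c.1, fun a b hab e => ?_⟩, rfl⟩
      by_cases he : s(a.1, b.1) = s(s, w)
      · rw [Sym2.eq_iff] at he
        rcases he with ⟨h1, h2⟩ | ⟨h1, h2⟩
        · obtain rfl : a = ⟨s, hs⟩ := Subtype.ext h1
          obtain rfl : b = ⟨w, hw⟩ := Subtype.ext h2
          exact hc e
        · obtain rfl : a = ⟨w, hw⟩ := Subtype.ext h1
          obtain rfl : b = ⟨s, hs⟩ := Subtype.ext h2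
          exact hc e.symm
      · exact c.2 a b (by rw [deleteEdges_adj]; exact ⟨hab, he⟩) e

/-! ### The convolution identity and its derivative. -/

/-- A coloring of `T` by two palettes is a coloring of some `S ⊆ T` by the first and of `T \ S` by
the second. -/
theorem card_coloringOn_add (G : SimpleGraph V) (T : Finset V) (k l : ℕ) :
    Nat.card (G.ColoringOn T (Fin (k + l))) = ∑ S ∈ T.powerset,
      Nat.card (G.ColoringOn S (Fin k)) * Nat.card (G.ColoringOn (T \ S) (Fin l)) := by
  classical
  have e₀ : G.ColoringOn T (Fin (k + l)) ≃ G.ColoringOn T (Fin k ⊕ Fin l) :=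
    { toFun := fun c => ⟨fun v => finSumFinEquiv.symm (c.1 v), fun a b hab e =>
        c.2 a b hab (finSumFinEquiv.symm.injective e)⟩
      invFun := fun c => ⟨fun v => finSumFinEquiv (c.1 v), fun a b hab e =>
        c.2 a b hab (finSumFinEquiv.injective e)⟩
      left_inv := fun c => Subtype.ext (funext fun v => by simp)
      right_inv := fun c => Subtype.ext (funext fun v => by simp) }
  rw [Nat.card_congr e₀]
  let Φ : (Σ S : T.powerset, G.ColoringOn S.1 (Fin k) × G.ColoringOn (T \ S.1) (Fin l)) →
      G.ColoringOn T (Fin k ⊕ Fin l) := fun x =>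
    ⟨fun v => if hv : v.1 ∈ x.1.1 then Sum.inl (x.2.1.1 ⟨v.1, hv⟩)
      else Sum.inr (x.2.2.1 ⟨v.1, mem_sdiff.2 ⟨v.2, hv⟩⟩), by
      intro a b hab
      by_cases ha : a.1 ∈ x.1.1 <;> by_cases hb : b.1 ∈ x.1.1 <;> simp only [ha, hb, dite_true,
        dite_false, ne_eq, Sum.inl.injEq, Sum.inr.injEq, reduceCtorEq, not_false_eq_true]
      · exact x.2.1.2 _ _ hab
      · exact x.2.2.2 _ _ hab⟩
  have hΦ (x) (v : T) : (Φ x).1 v = if hv : v.1 ∈ x.1.1 then Sum.inl (x.2.1.1 ⟨v.1, hv⟩)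
      else Sum.inr (x.2.2.1 ⟨v.1, mem_sdiff.2 ⟨v.2, hv⟩⟩) := rfl
  have hbij : Function.Bijective Φ := by
    constructor
    · rintro ⟨⟨S, hS⟩, c, d⟩ ⟨⟨S', hS'⟩, c', d'⟩ h
      have hv (v : T) := congrFun (congrArg Subtype.val h) v
      simp only [hΦ] at hv
      obtain rfl : S = S' := by
        ext v
        constructor
        · intro hvS
          by_contra hvS'
          simpa [hvS, hvS'] using hv ⟨v, mem_powerset.1 hS hvS⟩
        · intro hvS'
          by_contra hvS
          simpa [hvS, hvS'] using hv ⟨v, mem_powerset.1 hS' hvS'⟩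
      have hc : c = c' := Subtype.ext (funext fun v => by
        simpa using hv ⟨v, mem_powerset.1 hS v.2⟩)
      have hd : d = d' := Subtype.ext (funext fun v => by
        simpa [(mem_sdiff.1 v.2).2] using hv ⟨v, (mem_sdiff.1 v.2).1⟩)
      rw [hc, hd]
    · intro c
      have hS : T.attach.filter (fun v => (c.1 v).isLeft) |>.map (Function.Embedding.subtype _)
          |> (· ⊆ T) := by
        intro v hv
        simp only [mem_map, Function.Embedding.subtype_apply] at hv
        obtain ⟨a, _, rfl⟩ := hv
        exact a.2
      set S : Finset V := (T.attach.filter (fun v => (c.1 v).isLeft)).map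
        (Function.Embedding.subtype _) with hSdef
      have memS (v : T) : v.1 ∈ S ↔ (c.1 v).isLeft := by
        simp [hSdef]
      have memS' (v : T) (hv : v.1 ∈ T \ S) : (c.1 v).isRight := by
        have := (memS v).not.1 (mem_sdiff.1 hv).2
        simpa using this
      refine ⟨⟨⟨S, mem_powerset.2 hS⟩,
        ⟨fun v => (c.1 ⟨v.1, hS v.2⟩).getLeft ((memS ⟨v.1, hS v.2⟩).1 v.2), fun a b hab e => ?_⟩,
        ⟨fun v => (c.1 ⟨v.1, (mem_sdiff.1 v.2).1⟩).getRight
          (memS' ⟨v.1, (mem_sdiff.1 v.2).1⟩ v.2), fun a b hab e => ?_⟩⟩, ?_⟩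
      · refine c.2 ⟨a.1, hS a.2⟩ ⟨b.1, hS b.2⟩ hab ?_
        rw [← Sum.inl_getLeft _ ((memS ⟨a.1, hS a.2⟩).1 a.2),
          ← Sum.inl_getLeft _ ((memS ⟨b.1, hS b.2⟩).1 b.2)]
        exact congrArg Sum.inl e
      · refine c.2 ⟨a.1, (mem_sdiff.1 a.2).1⟩ ⟨b.1, (mem_sdiff.1 b.2).1⟩ hab ?_
        rw [← Sum.inr_getRight _ (memS' ⟨a.1, (mem_sdiff.1 a.2).1⟩ a.2),
          ← Sum.inr_getRight _ (memS' ⟨b.1, (mem_sdiff.1 b.2).1⟩ b.2)]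
        exact congrArg Sum.inr e
      · refine Subtype.ext (funext fun v => ?_)
        rw [hΦ]
        by_cases hv : v.1 ∈ S <;> simp [hv]
  rw [← Nat.card_congr (Equiv.ofBijective Φ hbij), Nat.card_sigma,
    ← Finset.sum_coe_sort T.powerset fun S => Nat.card (G.ColoringOn S (Fin k)) *
      Nat.card (G.ColoringOn (T \ S) (Fin l))]
  exact Finset.sum_congr rfl fun S _ => Nat.card_prod _ _

theorem chromaticPolynomialOn_comp_add (G : SimpleGraph V) (T : Finset V) {l : ℕ} (hl : 0 < l) :
    (G.chromaticPolynomialOn T).comp (X + C (l : ℝ)) = ∑ S ∈ T.powerset,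
      C ((G.chromaticPolynomialOn (T \ S)).eval (l : ℝ)) * G.chromaticPolynomialOn S := by
  refine polynomial_eq_of_eval_pos_nat fun k hk => ?_
  rw [eval_comp, eval_add, eval_X, eval_C, ← Nat.cast_add,
    eval_chromaticPolynomialOn _ _ (by omega), card_coloringOn_add, Nat.cast_sum,
    eval_finsetSum]
  refine Finset.sum_congr rfl fun S _ => ?_
  rw [eval_mul, eval_C, eval_chromaticPolynomialOn _ _ hk, eval_chromaticPolynomialOn _ _ hl,
    Nat.cast_mul, mul_comm]

theorem derivative_chromaticPolynomialOn (G : SimpleGraph V) (T : Finset V) :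
    derivative (G.chromaticPolynomialOn T) = ∑ S ∈ T.powerset,
      C ((derivative (G.chromaticPolynomialOn S)).eval 0) * G.chromaticPolynomialOn (T \ S) := by
  refine polynomial_eq_of_eval_pos_nat fun l hl => ?_
  have h := congrArg (fun p => (derivative p).eval 0) (G.chromaticPolynomialOn_comp_add T hl)
  simp only [derivative_comp, derivative_add, derivative_X, derivative_C, add_zero, one_mul,
    eval_comp, eval_add, eval_X, eval_C, zero_add, derivative_sum, derivative_C_mul,
    eval_finsetSum, eval_mul] at h
  rw [h, eval_finsetSum]
  refine Finset.sum_congr rfl fun S _ => ?_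
  rw [eval_mul, eval_C, mul_comm]

/-- Evaluate the shift by `1` at `0`: by induction only `S = ∅` and `S = T` survive, and the former
already equals the left side. -/
theorem eval_zero_chromaticPolynomialOn (G : SimpleGraph V) (T : Finset V) (hT : T.Nonempty) :
    (G.chromaticPolynomialOn T).eval 0 = 0 := by
  induction T using Finset.strongInduction with
  | H T ih =>
    have h := congrArg (fun p => p.eval 0) (G.chromaticPolynomialOn_comp_add T one_pos)
    simp only [eval_comp, eval_add, eval_X, eval_C, zero_add, eval_finsetSum, eval_mul] at h
    have hsub : ({∅, T} : Finset (Finset V)) ⊆ T.powerset := by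
      simp [insert_subset_iff]
    rw [← Finset.sum_subset hsub, Finset.sum_pair hT.ne_empty.symm] at h
    · simpa [chromaticPolynomialOn_empty] using h
    · intro S hS hS'
      simp only [mem_insert, mem_singleton, not_or] at hS'
      rw [ih S (Finset.ssubset_iff_subset_ne.2 ⟨mem_powerset.1 hS, hS'.2⟩)
        (nonempty_iff_ne_empty.2 hS'.1), mul_zero]

end SimpleGraph

/-! ### Signed polynomials and their linear coefficients. -/

namespace SimpleGraph

open Polynomial Finset

variable {V : Type*}

/-- `(-1) ^ |T| P(G[T], -y)`, where `P` is the chromatic polynomial. -/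
noncomputable def signedChromatic (G : SimpleGraph V) (T : Finset V) (y : ℝ) : ℝ :=
  (-1) ^ #T * (G.chromaticPolynomialOn T).eval (-y)

/-- The absolute value of the coefficient of `x` in the chromatic polynomial of `G[T]`. -/
noncomputable def linearCoeffOn (G : SimpleGraph V) (T : Finset V) : ℝ :=
  (-1) ^ (#T + 1) * (derivative (G.chromaticPolynomialOn T)).eval 0

theorem linearCoeffOn_empty (G : SimpleGraph V) : G.linearCoeffOn ∅ = 0 := by
  simp [linearCoeffOn, chromaticPolynomialOn_empty]

theorem signedChromatic_empty (G : SimpleGraph V) (y : ℝ) : G.signedChromatic ∅ y = 1 := by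
  simp [signedChromatic, chromaticPolynomialOn_empty]

theorem linearCoeffOn_congr {G H : SimpleGraph V} {T : Finset V}
    (h : ∀ a ∈ T, ∀ b ∈ T, G.Adj a b ↔ H.Adj a b) : G.linearCoeffOn T = H.linearCoeffOn T := by
  rw [linearCoeffOn, chromaticPolynomialOn_congr h, linearCoeffOn]

variable [DecidableEq V]

theorem signedChromatic_zero (G : SimpleGraph V) {T : Finset V} (hT : T.Nonempty) :
    G.signedChromatic T 0 = 0 := by
  rw [signedChromatic, neg_zero, eval_zero_chromaticPolynomialOn G T hT, mul_zero]

theorem hasDerivAt_signedChromatic (G : SimpleGraph V) (T : Finset V) (y : ℝ) :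
    HasDerivAt (G.signedChromatic T)
      (∑ S ∈ T.powerset, G.linearCoeffOn S * G.signedChromatic (T \ S) y) y := by
  have h := (((G.chromaticPolynomialOn T).hasDerivAt (-y)).comp y (hasDerivAt_neg y)).const_mul
    ((-1 : ℝ) ^ #T)
  refine h.congr_deriv ?_
  rw [derivative_chromaticPolynomialOn, eval_finsetSum, Finset.sum_mul, Finset.mul_sum]
  refine Finset.sum_congr rfl fun S hS => ?_
  rw [signedChromatic, linearCoeffOn, ← card_sdiff_add_card_eq_card (mem_powerset.1 hS), eval_mul,
    eval_C]
  ring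

theorem linearCoeffOn_singleton (G : SimpleGraph V) (s : V) : G.linearCoeffOn {s} = 1 := by
  rw [linearCoeffOn, chromaticPolynomialOn_of_isolated G (mem_singleton_self s) (by simp)]
  simp [chromaticPolynomialOn_empty]

theorem linearCoeffOn_of_isolated (G : SimpleGraph V) {T : Finset V} {s : V}
    (hs : s ∈ T) (h : ∀ a ∈ T, ¬ G.Adj s a) (hT : (T.erase s).Nonempty) :
    G.linearCoeffOn T = 0 := by
  rw [linearCoeffOn, chromaticPolynomialOn_of_isolated G hs h, derivative_mul]
  simp [eval_zero_chromaticPolynomialOn G _ hT]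

/-- Contraction removes one vertex, so the sign normalization turns the difference in
deletion–contraction into a sum. -/
theorem linearCoeffOn_eq_add (G : SimpleGraph V) {T : Finset V} {s w : V}
    (hs : s ∈ T) (hw : w ∈ T) (h : G.Adj s w) :
    G.linearCoeffOn T = (G.deleteEdges {s(s, w)}).linearCoeffOn T +
      (G.mergeInto s w).linearCoeffOn (T.erase w) := by
  rw [linearCoeffOn, linearCoeffOn, linearCoeffOn, chromaticPolynomialOn_deleteEdges G hs hw h,
    derivative_add, eval_add, ← card_erase_add_one hw]
  ring

/-- Induction on deleting and contracting the edges at a fixed vertex `s`. -/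
theorem deletion_contraction_induction (s : V) {P : SimpleGraph V → Finset V → Prop}
    (single : ∀ G, P G {s})
    (isolated : ∀ G T, s ∈ T → (T.erase s).Nonempty → (∀ a ∈ T, ¬ G.Adj s a) → P G T)
    (step : ∀ G T w, s ∈ T → w ∈ T → G.Adj s w → P (G.deleteEdges {s(s, w)}) T →
      P (G.mergeInto s w) (T.erase w) → P G T)
    (G : SimpleGraph V) (T : Finset V) (hs : s ∈ T) : P G T := by
  classical
  -- Lexicographic induction: contraction lowers `#T`, while deletion keeps it and lowers the degree
  -- of `s` in `T`.
  induction hn : #T using Nat.strong_induction_on generalizing G T with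
  | _ n ihn =>
    induction hm : #(T.filter (G.Adj s)) using Nat.strong_induction_on generalizing G with
    | _ m ihm =>
      by_cases hT : (T.erase s).Nonempty
      · by_cases h : ∀ a ∈ T, ¬ G.Adj s a
        · exact isolated G T hs hT h
        · push Not at h
          obtain ⟨w, hw, hsw⟩ := h
          refine step G T w hs hw hsw (ihm _ ?_ _ rfl)
            (ihn _ (hn ▸ card_erase_lt_of_mem hw) _ _ (mem_erase.2 ⟨hsw.ne, hs⟩) rfl)
          rw [← hm]
          refine card_lt_card (Finset.ssubset_iff_of_subset ?_ |>.2 ⟨w, ?_, ?_⟩)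
          · intro a ha
            simp only [mem_filter] at ha ⊢
            exact ⟨ha.1, deleteEdges_le _ ha.2⟩
          · exact mem_filter.2 ⟨hw, hsw⟩
          · simp [deleteEdges_adj]
      · rw [not_nonempty_iff_eq_empty, erase_eq_empty_iff] at hT
        rcases hT with rfl | rfl
        · exact (notMem_empty _ hs).elim
        · exact single G

theorem linearCoeffOn_nonneg (G : SimpleGraph V) (T : Finset V) : 0 ≤ G.linearCoeffOn T := by
  rcases T.eq_empty_or_nonempty with rfl | ⟨s, hs⟩
  · rw [linearCoeffOn_empty]
  · refine deletion_contraction_induction s (P := fun G T => 0 ≤ G.linearCoeffOn T)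
      (fun G => ?_) (fun G T hs hT h => ?_) (fun G T w hs hw h h₁ h₂ => ?_) G T hs
    · rw [linearCoeffOn_singleton]
      exact zero_le_one
    · rw [linearCoeffOn_of_isolated G hs h hT]
    · rw [linearCoeffOn_eq_add G hs hw h]
      exact add_nonneg h₁ h₂

/-- Both sides decompose under deletion–contraction of `sw`: terms with `u ≠ w` split in two, and
the term `u = w` does not see the edge. -/
theorem linearCoeffOn_le_sum (G : SimpleGraph V) (T : Finset V) {s : V} (hs : s ∈ T)
    (hT : (T.erase s).Nonempty) :
    G.linearCoeffOn T ≤ ∑ u ∈ T.erase s, G.linearCoeffOn (T.erase u) := by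
  refine deletion_contraction_induction s (P := fun G T => (T.erase s).Nonempty →
    G.linearCoeffOn T ≤ ∑ u ∈ T.erase s, G.linearCoeffOn (T.erase u))
      (fun G h => ?_) (fun G T hs hT h _ => ?_) (fun G T w hs hw h h₁ h₂ hT => ?_) G T hs hT
  · simp at h
  · rw [linearCoeffOn_of_isolated G hs h hT]
    exact Finset.sum_nonneg fun u _ => linearCoeffOn_nonneg _ _
  · have hws : w ∈ T.erase s := mem_erase.2 ⟨h.ne', hw⟩
    have hdel : (G.deleteEdges {s(s, w)}).linearCoeffOn (T.erase w) =
        G.linearCoeffOn (T.erase w) := by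
      refine linearCoeffOn_congr fun a ha b hb => ?_
      rw [deleteEdges_adj, and_iff_left]
      intro e
      rw [Set.mem_singleton_iff, Sym2.eq_iff] at e
      rcases e with e | e
      · exact ne_of_mem_erase hb e.2
      · exact ne_of_mem_erase ha e.1
    have hsum : ∑ u ∈ (T.erase s).erase w, G.linearCoeffOn (T.erase u) =
        ∑ u ∈ (T.erase s).erase w, (G.deleteEdges {s(s, w)}).linearCoeffOn (T.erase u) +
        ∑ u ∈ (T.erase w).erase s, (G.mergeInto s w).linearCoeffOn ((T.erase w).erase u) := by
      rw [erase_right_comm (a := w), ← Finset.sum_add_distrib]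
      refine Finset.sum_congr rfl fun u hu => ?_
      simp only [mem_erase] at hu
      rw [linearCoeffOn_eq_add G (mem_erase.2 ⟨Ne.symm hu.2.1, hs⟩)
        (mem_erase.2 ⟨Ne.symm hu.1, hw⟩) h, erase_right_comm]
    rw [linearCoeffOn_eq_add G hs hw h]
    have h₁ := h₁ hT
    rw [← Finset.add_sum_erase _ _ hws] at h₁ ⊢
    rw [hsum]
    rw [hdel] at h₁
    by_cases hne : ((T.erase w).erase s).Nonempty
    · linarith [h₂ hne]
    -- Here `T = {s, w}`: the contraction is a single vertex, for which the bound fails, but both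
    -- sides for `T` equal `1`.
    · rw [not_nonempty_iff_eq_empty] at hne
      have hw' : T.erase w = {s} := by
        rw [erase_eq_empty_iff] at hne
        rcases hne with hne | hne
        · exact absurd (mem_erase.2 ⟨h.ne, hs⟩) (hne ▸ notMem_empty _)
        · exact hne
      have hiso : (G.deleteEdges {s(s, w)}).linearCoeffOn T = 0 := by
        refine linearCoeffOn_of_isolated _ hs (fun a ha => ?_) hT
        rw [deleteEdges_adj]
        rintro ⟨hsa, hne'⟩
        have : a ∈ T.erase w := mem_erase.2 ⟨fun e => hne' (by simp [e]), ha⟩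
        rw [hw', mem_singleton] at this
        exact hsa.ne this.symm
      rw [erase_right_comm, hne, hiso, hw']
      simp [linearCoeffOn_singleton]

/-- `q_T` vanishes at `0` for nonempty `T`, and its derivative is positive because the term `S =
{s}` is. -/
theorem signedChromatic_pos (G : SimpleGraph V) (T : Finset V) {y : ℝ} (hy : 0 < y) :
    0 < G.signedChromatic T y := by
  induction T using Finset.strongInduction generalizing y with
  | H T ih =>
    rcases T.eq_empty_or_nonempty with rfl | ⟨s, hs⟩
    · rw [signedChromatic_empty]
      exact one_pos
    · rw [← G.signedChromatic_zero ⟨s, hs⟩]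
      refine strictMonoOn_of_deriv_pos (convex_Ici 0)
        (fun z _ => (G.hasDerivAt_signedChromatic T z).continuousAt.continuousWithinAt)
        (fun z hz => ?_) Set.self_mem_Ici hy.le hy
      rw [interior_Ici, Set.mem_Ioi] at hz
      rw [(G.hasDerivAt_signedChromatic T z).deriv]
      have hpos (S : Finset V) (hS : S ∈ T.powerset) (hne : S.Nonempty) :
          0 < G.signedChromatic (T \ S) z :=
        ih _ (sdiff_ssubset (mem_powerset.1 hS) hne) hz
      refine Finset.sum_pos' (fun S hS => ?_) ⟨{s}, by simpa using hs, ?_⟩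
      · rcases S.eq_empty_or_nonempty with rfl | hne
        · rw [linearCoeffOn_empty, zero_mul]
        · exact mul_nonneg (linearCoeffOn_nonneg _ _) (hpos S hS hne).le
      · rw [linearCoeffOn_singleton, one_mul]
        exact hpos _ (by simpa using hs) (singleton_nonempty s)

/-! ### The excess inequalities. -/

/-- The excess `(|T| - 1) ∑ b(T - u) - |T| b(T)`, corrected by one when `|T| = 1`. -/
noncomputable def linearCoeffExcess (G : SimpleGraph V) (T : Finset V) : ℝ :=
  ((#T : ℝ) - 1) * ∑ u ∈ T, G.linearCoeffOn (T.erase u) - #T * G.linearCoeffOn T +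
    if #T = 1 then 1 else 0

theorem linearCoeffExcess_nonneg (G : SimpleGraph V) (T : Finset V) :
    0 ≤ G.linearCoeffExcess T := by
  rw [linearCoeffExcess]
  by_cases h1 : #T = 1
  · obtain ⟨s, rfl⟩ := card_eq_one.1 h1
    simp [linearCoeffOn_singleton]
  · have h : ∑ s ∈ T, G.linearCoeffOn T ≤
        ∑ s ∈ T, ∑ u ∈ T.erase s, G.linearCoeffOn (T.erase u) := by
      refine Finset.sum_le_sum fun s hs => G.linearCoeffOn_le_sum T hs ?_
      rw [← card_pos, card_erase_of_mem hs]
      have := card_pos.2 ⟨s, hs⟩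
      omega
    -- Each `u` is counted once for every `s ≠ u`.
    have h2 : ∑ s ∈ T, ∑ u ∈ T.erase s, G.linearCoeffOn (T.erase u) =
        ((#T : ℝ) - 1) * ∑ u ∈ T, G.linearCoeffOn (T.erase u) := by
      rw [Finset.sum_congr rfl fun s hs => eq_sub_of_add_eq'
        (Finset.add_sum_erase T (fun u => G.linearCoeffOn (T.erase u)) hs),
        Finset.sum_sub_distrib, Finset.sum_const, nsmul_eq_mul]
      ring
    rw [Finset.sum_const, nsmul_eq_mul, h2] at h
    rw [if_neg h1]
    linarith

theorem linearCoeffExcess_pair (G : SimpleGraph V) {u v : V} (huv : u ≠ v) (h : ¬ G.Adj u v) :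
    0 < G.linearCoeffExcess {u, v} := by
  have h0 : G.linearCoeffOn {u, v} = 0 := by
    refine linearCoeffOn_of_isolated G (mem_insert_self u {v}) ?_ ⟨v, by simp [huv.symm]⟩
    simp [h]
  have hu : ({u, v} : Finset V).erase u = {v} := by simp [huv]
  have hv : ({u, v} : Finset V).erase v = {u} := by
    rw [pair_comm]
    simp [huv.symm]
  rw [linearCoeffExcess, h0, card_pair huv, Finset.sum_pair huv, hu, hv]
  simp [linearCoeffOn_singleton]

/-- `(y + |T| - 1) ∑ q(T - u) - |T| q(T)`, where `q` is the signed chromatic polynomial. -/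
noncomputable def chromaticExcess (G : SimpleGraph V) (T : Finset V) (y : ℝ) : ℝ :=
  (y + #T - 1) * ∑ u ∈ T, G.signedChromatic (T.erase u) y - #T * G.signedChromatic T y

theorem chromaticExcess_zero (G : SimpleGraph V) (T : Finset V) : G.chromaticExcess T 0 = 0 := by
  rw [chromaticExcess]
  rcases T.eq_empty_or_nonempty with rfl | hT
  · simp
  · rw [signedChromatic_zero G hT]
    by_cases h1 : #T = 1
    · simp [h1]
    · rw [Finset.sum_eq_zero]
      · ring
      · intro u hu
        refine signedChromatic_zero G ?_
        rw [← card_pos, card_erase_of_mem hu]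
        have := card_pos.2 hT
        omega

theorem sum_powerset_sum_sdiff {M : Type*} [AddCommMonoid M] (T : Finset V)
    (f : Finset V → V → M) :
    ∑ S ∈ T.powerset, ∑ u ∈ T \ S, f S u = ∑ u ∈ T, ∑ S ∈ (T.erase u).powerset, f S u := by
  refine Finset.sum_comm' fun S u => ?_
  simp only [mem_powerset, mem_sdiff, subset_erase]
  tauto

theorem sum_powerset_sum_mem {M : Type*} [AddCommMonoid M] (T : Finset V)
    (f : Finset V → V → M) :
    ∑ S ∈ T.powerset, ∑ u ∈ S, f S u =
      ∑ S ∈ T.powerset, ∑ u ∈ T \ S, f (insert u S) u := by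
  rw [Finset.sum_sigma', Finset.sum_sigma']
  refine Finset.sum_bij' (fun x _ => ⟨x.1.erase x.2, x.2⟩) (fun x _ => ⟨insert x.2 x.1, x.2⟩)
    ?_ ?_ ?_ ?_ ?_
  · rintro ⟨S, u⟩ h
    simp only [mem_sigma, mem_powerset, mem_sdiff] at h ⊢
    exact ⟨(erase_subset _ _).trans h.1, h.1 h.2, notMem_erase _ _⟩
  · rintro ⟨S, u⟩ h
    simp only [mem_sigma, mem_powerset, mem_sdiff] at h ⊢
    exact ⟨insert_subset h.2.1 h.1, mem_insert_self _ _⟩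
  · rintro ⟨S, u⟩ h
    simp only [mem_sigma] at h
    simp [insert_erase h.2]
  · rintro ⟨S, u⟩ h
    simp only [mem_sigma, mem_sdiff] at h
    simp [erase_insert h.2.2]
  · rintro ⟨S, u⟩ h
    simp only [mem_sigma] at h
    simp [insert_erase h.2]

theorem hasDerivAt_chromaticExcess (G : SimpleGraph V) (T : Finset V) (y : ℝ) :
    HasDerivAt (G.chromaticExcess T)
      (∑ S ∈ T.powerset, (G.linearCoeffOn S * G.chromaticExcess (T \ S) y +
        G.linearCoeffExcess S * G.signedChromatic (T \ S) y)) y := by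
  have h1 : HasDerivAt (fun y : ℝ => y + #T - 1) 1 y := ((hasDerivAt_id y).add_const _).sub_const _
  have h2 : HasDerivAt (fun y => ∑ u ∈ T, G.signedChromatic (T.erase u) y)
      (∑ u ∈ T, ∑ S ∈ (T.erase u).powerset,
        G.linearCoeffOn S * G.signedChromatic (T.erase u \ S) y) y :=
    HasDerivAt.fun_sum fun u _ => G.hasDerivAt_signedChromatic (T.erase u) y
  refine ((h1.mul h2).sub ((G.hasDerivAt_signedChromatic T y).const_mul (#T : ℝ))).congr_deriv ?_
  rw [← sum_powerset_sum_sdiff T fun S u =>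
    G.linearCoeffOn S * G.signedChromatic (T.erase u \ S) y]
  -- The derivative of the factor `y + #T - 1` contributes this sum; it is the source of the
  -- correction at `#S = 1`.
  have hA : ∑ u ∈ T, G.signedChromatic (T.erase u) y =
      ∑ S ∈ T.powerset, (if #S = 1 then 1 else 0) * G.signedChromatic (T \ S) y := by
    simp only [ite_mul, one_mul, zero_mul]
    rw [← Finset.sum_filter, ← powersetCard_eq_filter, powersetCard_one, Finset.sum_map]
    simp [sdiff_singleton_eq_erase]
  -- Reindex by moving `u` from `S` to its complement; the weight `#S - 1` becomes `#S`.
  have hB : ∑ S ∈ T.powerset,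
        (((#S : ℝ) - 1) * ∑ u ∈ S, G.linearCoeffOn (S.erase u)) * G.signedChromatic (T \ S) y =
      ∑ S ∈ T.powerset, #S * G.linearCoeffOn S *
        ∑ u ∈ T \ S, G.signedChromatic ((T \ S).erase u) y := by
    have := sum_powerset_sum_mem T fun S u =>
      ((#S : ℝ) - 1) * G.linearCoeffOn (S.erase u) * G.signedChromatic (T \ S) y
    simp only [Finset.mul_sum, Finset.sum_mul] at this ⊢
    rw [this]
    refine Finset.sum_congr rfl fun S _ => Finset.sum_congr rfl fun u hu => ?_
    have hu' := (mem_sdiff.1 hu).2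
    rw [card_insert_of_notMem hu', erase_insert hu', sdiff_insert]
    push_cast
    ring
  have hC : ∑ S ∈ T.powerset, G.linearCoeffExcess S * G.signedChromatic (T \ S) y =
      ∑ S ∈ T.powerset, #S * G.linearCoeffOn S *
        ∑ u ∈ T \ S, G.signedChromatic ((T \ S).erase u) y -
      ∑ S ∈ T.powerset, #S * G.linearCoeffOn S * G.signedChromatic (T \ S) y +
      ∑ u ∈ T, G.signedChromatic (T.erase u) y := by
    rw [hA, ← hB, ← Finset.sum_sub_distrib, ← Finset.sum_add_distrib]
    refine Finset.sum_congr rfl fun S _ => ?_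
    rw [linearCoeffExcess]
    ring
  rw [Finset.sum_add_distrib, hC, one_mul, add_comm (∑ u ∈ T, _), ← add_assoc,
    add_sub_right_comm, add_left_inj, Finset.mul_sum, Finset.mul_sum, ← Finset.sum_sub_distrib,
    ← Finset.sum_sub_distrib, ← Finset.sum_add_distrib]
  refine Finset.sum_congr rfl fun S hS => ?_
  have hcard : (#T : ℝ) = #(T \ S) + #S := by
    exact_mod_cast (card_sdiff_add_card_eq_card (mem_powerset.1 hS)).symm
  have hsd (u : V) : T.erase u \ S = (T \ S).erase u := erase_sdiff_comm T S u
  simp only [hsd, ← Finset.mul_sum]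
  rw [chromaticExcess, hcard]
  ring

theorem chromaticExcess_nonneg (G : SimpleGraph V) (T : Finset V) {y : ℝ} (hy : 0 ≤ y) :
    0 ≤ G.chromaticExcess T y := by
  induction T using Finset.strongInduction generalizing y with
  | H T ih =>
    rw [← G.chromaticExcess_zero T]
    refine monotoneOn_of_deriv_nonneg (convex_Ici 0)
      (fun z _ => (G.hasDerivAt_chromaticExcess T z).continuousAt.continuousWithinAt)
      (fun z _ => (G.hasDerivAt_chromaticExcess T z).differentiableAt.differentiableWithinAt)
      (fun z hz => ?_) Set.self_mem_Ici hy hy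
    rw [interior_Ici, Set.mem_Ioi] at hz
    rw [(G.hasDerivAt_chromaticExcess T z).deriv]
    refine Finset.sum_nonneg fun S hS => add_nonneg ?_
      (mul_nonneg (G.linearCoeffExcess_nonneg S) (G.signedChromatic_pos _ hz).le)
    -- The term `S = ∅` would need the statement for `T` itself, but its coefficient is zero.
    rcases S.eq_empty_or_nonempty with rfl | hne
    · rw [linearCoeffOn_empty, zero_mul]
    · exact mul_nonneg (G.linearCoeffOn_nonneg S)
        (ih _ (sdiff_ssubset (mem_powerset.1 hS) hne) hz.le)

theorem chromaticExcess_pos (G : SimpleGraph V) {T : Finset V} {u v : V} (hu : u ∈ T) (hv : v ∈ T)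
    (huv : u ≠ v) (h : ¬ G.Adj u v) {y : ℝ} (hy : 0 < y) : 0 < G.chromaticExcess T y := by
  rw [← G.chromaticExcess_zero T]
  refine strictMonoOn_of_deriv_pos (convex_Ici 0)
    (fun z _ => (G.hasDerivAt_chromaticExcess T z).continuousAt.continuousWithinAt)
    (fun z hz => ?_) Set.self_mem_Ici hy.le hy
  rw [interior_Ici, Set.mem_Ioi] at hz
  rw [(G.hasDerivAt_chromaticExcess T z).deriv]
  refine Finset.sum_pos' (fun S _ => add_nonneg
      (mul_nonneg (G.linearCoeffOn_nonneg S) (G.chromaticExcess_nonneg _ hz.le))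
      (mul_nonneg (G.linearCoeffExcess_nonneg S) (G.signedChromatic_pos _ hz).le))
    ⟨{u, v}, mem_powerset.2 (by simp [insert_subset_iff, hu, hv]), add_pos_of_nonneg_of_pos
      (mul_nonneg (G.linearCoeffOn_nonneg _) (G.chromaticExcess_nonneg _ hz.le))
      (mul_pos (G.linearCoeffExcess_pair huv h) (G.signedChromatic_pos _ hz))⟩

end SimpleGraph

/-! ### Return to the original signs, with `y = -x`. -/

theorem mainTheorem3 {V : Type*} [Fintype V] (G : SimpleGraph V) (n : ℕ)
    (hn : Fintype.card V = n) (hG : G ≠ ⊤) (x : ℝ) (hx : x < 0) :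
    0 < (-1 : ℝ) ^ n * (x - (n : ℝ) + 1) *
          ∑ u : V, (G.induce ({u}ᶜ : Set V)).chromaticPolynomial.eval x
        + (-1 : ℝ) ^ (n + 1) * (n : ℝ) * G.chromaticPolynomial.eval x := by
  classical
  obtain ⟨u, v, huv, hadj⟩ : ∃ u v, u ≠ v ∧ ¬ G.Adj u v := by
    by_contra! h
    exact hG (SimpleGraph.ext (by
      ext a b
      exact ⟨fun hab => hab.ne, fun hab => h a b hab⟩))
  refine (G.chromaticExcess_pos (Finset.mem_univ u) (Finset.mem_univ v) huv hadj
    (neg_pos.2 hx)).trans_eq ?_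
  have herase (w : V) : G.signedChromatic (Finset.univ.erase w) (-x) =
      (-1) ^ (n + 1) * (G.induce ({w}ᶜ : Set V)).chromaticPolynomial.eval x := by
    -- The vertex type depends on the set, so the equality of sets is generalized before
    -- substitution.
    have hset : ∀ s : Set V, s = {w}ᶜ → (G.induce s).chromaticPolynomial =
        (G.induce ({w}ᶜ : Set V)).chromaticPolynomial := by
      rintro s rfl
      rfl
    have hcompl : ((Finset.univ.erase w : Finset V) : Set V) = {w}ᶜ := by
      ext
      simp
    have hcard : n + 1 = (Finset.univ.erase w).card + 2 := by
      rw [← hn, ← Finset.card_univ, ← Finset.card_erase_add_one (Finset.mem_univ w)]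
    rw [SimpleGraph.signedChromatic, SimpleGraph.chromaticPolynomialOn, neg_neg, hcard,
      pow_add, neg_one_sq, mul_one]
    exact congrArg (fun p : Polynomial ℝ => _ * p.eval x) (hset _ hcompl)
  rw [SimpleGraph.chromaticExcess, Finset.sum_congr rfl fun w _ => herase w, ← Finset.mul_sum,
    SimpleGraph.signedChromatic, SimpleGraph.chromaticPolynomialOn_univ, Finset.card_univ, hn,
    neg_neg]
  ring
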